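/- Let $R$ be a commutative ring with unity and let $C$ be a semidualizing $R$-module, i.e. an $R$-module such that (1) $C$ has a projective resolution by finitely generated projective modules, (2) the homothety map $R\to\operatorname{Hom}_R(C,C)$ is an isomorphism, and (3) $\operatorname{Ext}^i_R(C,C)=0$ for all $i\ge 1$. An $R$-module $M$ is called $G_C$-projective if there is an exact sequence of $R$-modules $$\mathbb X=\cdots\to P_1\to P_0\to C\otimes_R P_{-1}\to C\otimes_R P_{-2}\to\cdots$$ with all $P_i$ projective, such that $M\cong\operatorname{im}(P_0\to C\otimes_R P_{-1})$ and $\operatorname{Hom}_R(\mathbb X,C\otimes_R P)$ is exact for every projective $R$-module $P$. The ring $R$ is called $G_C$-hereditary if every submodule of a projective $R$-module is $G_C$-projective. If $R$ is $G_C$-hereditary, then $R$ is coherent, i.e. every finitely generated ideal of $R$ is finitely presented. -/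

import Mathlib

open scoped TensorProduct

universe u

/-- `C` admits a degreewise finite projective resolution: an exact sequence
`⋯ → P 1 → P 0 → C → 0` with all `P n` finitely generated projective. -/
def HasDegreewiseFiniteProjectiveResolution (R : Type u) [CommRing R]
    (C : Type u) [AddCommGroup C] [Module R C] : Prop :=
  ∃ (P : ℕ → ModuleCat.{u} R) (d : ∀ n, P (n + 1) →ₗ[R] P n) (ε : P 0 →ₗ[R] C),
    (∀ n, Module.Finite R (P n)) ∧ (∀ n, Module.Projective R (P n)) ∧
    Function.Surjective ε ∧ Function.Exact (d 0) ε ∧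
    ∀ n, Function.Exact (d (n + 1)) (d n)

/-- Semidualizing modules over a commutative ring. -/
structure IsSemidualizing (R : Type u) [CommRing R]
    (C : Type u) [AddCommGroup C] [Module R C] : Prop where
  /-- `C` has a degreewise finite projective resolution. -/
  resolution : HasDegreewiseFiniteProjectiveResolution R C
  /-- The homothety map `R → Hom_R(C, C)`, `r ↦ (c ↦ r • c)`, is an isomorphism. -/
  homothety : Function.Bijective (LinearMap.lsmul R C : R →ₗ[R] C →ₗ[R] C)
  /-- `Ext^i_R(C, C) = 0` for all `i ≥ 1`. -/
  ext_vanishing : ∀ i : ℕ, 1 ≤ i →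
    Subsingleton (CategoryTheory.Abelian.Ext (ModuleCat.of R C) (ModuleCat.of R C) i)

/-- An exact sequence
`⋯ → P 1 → P 0 → C ⊗ Q 0 → C ⊗ Q 1 → ⋯`
with all `P n`, `Q n` projective, which stays exact after applying `Hom_R(-, C ⊗ W)` for every
projective module `W`. (Here `Q n` is the module usually written `P_{-(n+1)}`.) -/
structure CompleteGCResolution (R : Type u) [CommRing R]
    (C : Type u) [AddCommGroup C] [Module R C] where
  /-- The projective modules in the left half. -/
  P : ℕ → ModuleCat.{u} R
  /-- The projective modules that are tensored with `C` in the right half. -/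
  Q : ℕ → ModuleCat.{u} R
  /-- The differentials of the left half. -/
  dP : ∀ n, P (n + 1) →ₗ[R] P n
  /-- The differential joining the two halves. -/
  δ : P 0 →ₗ[R] C ⊗[R] Q 0
  /-- The differentials of the right half. -/
  dQ : ∀ n, C ⊗[R] Q n →ₗ[R] C ⊗[R] Q (n + 1)
  projective_P : ∀ n, Module.Projective R (P n)
  projective_Q : ∀ n, Module.Projective R (Q n)
  exact_P : ∀ n, Function.Exact (dP (n + 1)) (dP n)
  exact_P_δ : Function.Exact (dP 0) δ
  exact_δ_Q : Function.Exact δ (dQ 0)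
  exact_Q : ∀ n, Function.Exact (dQ n) (dQ (n + 1))
  hom_exact_P : ∀ (W : Type u) [AddCommGroup W] [Module R W] [Module.Projective R W] (n : ℕ),
    Function.Exact (fun f : P n →ₗ[R] C ⊗[R] W => f ∘ₗ dP n)
      (fun f : P (n + 1) →ₗ[R] C ⊗[R] W => f ∘ₗ dP (n + 1))
  hom_exact_P_δ : ∀ (W : Type u) [AddCommGroup W] [Module R W] [Module.Projective R W],
    Function.Exact (fun f : C ⊗[R] Q 0 →ₗ[R] C ⊗[R] W => f ∘ₗ δ)
      (fun f : P 0 →ₗ[R] C ⊗[R] W => f ∘ₗ dP 0)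
  hom_exact_δ_Q : ∀ (W : Type u) [AddCommGroup W] [Module R W] [Module.Projective R W],
    Function.Exact (fun f : C ⊗[R] Q 1 →ₗ[R] C ⊗[R] W => f ∘ₗ dQ 0)
      (fun f : C ⊗[R] Q 0 →ₗ[R] C ⊗[R] W => f ∘ₗ δ)
  hom_exact_Q : ∀ (W : Type u) [AddCommGroup W] [Module R W] [Module.Projective R W] (n : ℕ),
    Function.Exact (fun f : C ⊗[R] Q (n + 2) →ₗ[R] C ⊗[R] W => f ∘ₗ dQ (n + 1))
      (fun f : C ⊗[R] Q (n + 1) →ₗ[R] C ⊗[R] W => f ∘ₗ dQ n)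

/-- `M` is `G_C`-projective: it is isomorphic to the image of `P 0 → C ⊗ Q 0` in some
sequence as above. -/
def IsGCProjective (R : Type u) [CommRing R] (C : Type u) [AddCommGroup C] [Module R C]
    (M : Type u) [AddCommGroup M] [Module R M] : Prop :=
  ∃ X : CompleteGCResolution R C, Nonempty (M ≃ₗ[R] LinearMap.range X.δ)

/-- `R` is `G_C`-hereditary: every submodule of a projective module is `G_C`-projective. -/
def IsGCHereditary (R : Type u) [CommRing R] (C : Type u) [AddCommGroup C] [Module R C] : Prop :=
  ∀ (P : Type u) [AddCommGroup P] [Module R P] [Module.Projective R P] (N : Submodule R P),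
    IsGCProjective R C N

/-- A commutative ring is coherent if every finitely generated ideal is finitely presented. -/
def IsCoherentCommRing (R : Type u) [CommRing R] : Prop :=
  ∀ I : Ideal R, I.FG → Module.FinitePresentation R I

/-! Write X* for Hom(X, C). Let M be a finitely generated submodule of a projective module. Being
G_C-projective, M has coresolutions by summands of sums of C that stay exact under Hom into such
summands; finite generation and a dual Schanuel argument replace the terms by finite powers of C
(`HasCoresolution.hasFiniteCoresolution`). Take 0 → M → C^ι → N → 0. Since R ≅ Hom(C, C), N* embeds
in R^ι, and it is finitely generated, so the hypothesis on R applies again: 0 → N* → C^κ → L → 0.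
Dualizing, and using N ≅ N** (`applyₗ_bijective`), gives 0 → L* → R^κ → N → 0 with L* finitely
presented. Comparing the two presentations of N through their pullback shows that M is finitely
presented (`finitePresentation_of_exact`). -/

namespace GCHereditary

/-! ### Coresolutions relative to summands of sums of C -/

section RelativeCoresolutions

variable {R : Type u} [CommRing R] (C : Type u) [AddCommGroup C] [Module R C]

/-- `D` is a direct summand of a direct sum of copies of `C`. -/
def IsAddClosure (D : Type u) [AddCommGroup D] [Module R D] : Prop :=
  ∃ (ι : Type u) (i : D →ₗ[R] ι →₀ C) (s : (ι →₀ C) →ₗ[R] D), ∀ x, s (i x) = x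

/-- A short exact sequence `0 → M → D → N → 0` with `D` in the additive closure of `C` which
stays exact under `Hom_R(-, D')` for all `D'` in the additive closure of `C`. -/
structure IsCostep {M D N : Type u} [AddCommGroup M] [Module R M] [AddCommGroup D] [Module R D]
    [AddCommGroup N] [Module R N] (f : M →ₗ[R] D) (g : D →ₗ[R] N) : Prop where
  isAddClosure : IsAddClosure (R := R) C D
  injective : Function.Injective f
  exact : Function.Exact f g
  surjective : Function.Surjective g
  extends_to : ∀ (D' : Type u) [AddCommGroup D'] [Module R D'], IsAddClosure (R := R) C D' →
    ∀ φ : M →ₗ[R] D', ∃ ψ : D →ₗ[R] D', ∀ x, ψ (f x) = φ x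

/-- `M` admits `k` successive steps of a coresolution by modules in the additive closure of `C`
which is exact relative to that closure. -/
def HasCoresolution : ℕ → ∀ (M : Type u) [AddCommGroup M] [Module R M], Prop
  | 0, _, _, _ => True
  | k + 1, M, _, _ => ∃ (D N : ModuleCat.{u} R) (f : M →ₗ[R] D) (g : D →ₗ[R] N),
      IsCostep C f g ∧ HasCoresolution k N

/-- `M` admits `k` successive steps of a coresolution by finite direct sums of copies of `C` which
is exact relative to `C`. -/
def HasFiniteCoresolution : ℕ → ∀ (M : Type u) [AddCommGroup M] [Module R M], Prop
  | 0, _, _, _ => True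
  | k + 1, M, _, _ => ∃ (ι : Type u) (_ : Finite ι) (N : ModuleCat.{u} R)
      (f : M →ₗ[R] ι → C) (g : (ι → C) →ₗ[R] N),
      IsCostep C f g ∧ HasFiniteCoresolution k N

variable {C}
variable {M N D : Type u} [AddCommGroup M] [Module R M] [AddCommGroup N] [Module R N]
  [AddCommGroup D] [Module R D]

lemma IsAddClosure.prod (hM : IsAddClosure (R := R) C M) (hN : IsAddClosure (R := R) C N) :
    IsAddClosure (R := R) C (M × N) := by
  obtain ⟨ι, i, s, h⟩ := hM
  obtain ⟨κ, j, t, h'⟩ := hN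
  let e := Finsupp.sumFinsuppLEquivProdFinsupp (α := ι) (β := κ) (M := C) R
  refine ⟨ι ⊕ κ, e.symm.toLinearMap ∘ₗ i.prodMap j, s.prodMap t ∘ₗ e.toLinearMap, fun x => ?_⟩
  simp [h, h']

lemma isAddClosure_pi (ι : Type u) [Finite ι] : IsAddClosure (R := R) C (ι → C) :=
  ⟨ι, (Finsupp.linearEquivFunOnFinite R C ι).symm.toLinearMap,
    (Finsupp.linearEquivFunOnFinite R C ι).toLinearMap, fun x => by simp⟩

lemma isAddClosure_self : IsAddClosure (R := R) C C :=
  ⟨PUnit, Finsupp.lsingle PUnit.unit, Finsupp.lapply PUnit.unit, fun x => by simp⟩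

lemma isAddClosure_tensor (Q : Type u) [AddCommGroup Q] [Module R Q] [Module.Projective R Q] :
    IsAddClosure (R := R) C (C ⊗[R] Q) := by
  classical
  obtain ⟨s, hs⟩ := Module.projective_def'.mp (inferInstance : Module.Projective R Q)
  let e := TensorProduct.finsuppScalarRight R R C Q
  refine ⟨Q, e.toLinearMap ∘ₗ s.lTensor C,
    (Finsupp.linearCombination R id).lTensor C ∘ₗ e.symm.toLinearMap, fun x => ?_⟩
  have := LinearMap.lTensor_comp C (Finsupp.linearCombination R id) s
  rw [hs, LinearMap.lTensor_id] at this
  simpa using (LinearMap.congr_fun this x).symm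

lemma HasCoresolution.of_equiv {k : ℕ} (e : M ≃ₗ[R] N) (h : HasCoresolution (R := R) C k M) :
    HasCoresolution (R := R) C k N := by
  cases k with
  | zero => trivial
  | succ k =>
    obtain ⟨D, L, f, g, hfg, hL⟩ := h
    refine ⟨D, L, f ∘ₗ e.symm.toLinearMap, g, ⟨hfg.isAddClosure, ?_, ?_, hfg.surjective, ?_⟩, hL⟩
    · exact hfg.injective.comp e.symm.injective
    · intro x
      rw [hfg.exact x]
      constructor
      · rintro ⟨y, rfl⟩
        exact ⟨e y, by simp⟩
      · rintro ⟨y, rfl⟩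
        exact ⟨e.symm y, rfl⟩
    · intro D' _ _ hD' φ
      obtain ⟨ψ, hψ⟩ := hfg.extends_to D' hD' (φ ∘ₗ e.toLinearMap)
      exact ⟨ψ, fun x => by simpa using hψ (e.symm x)⟩

lemma HasCoresolution.prod {k : ℕ} (hD : IsAddClosure (R := R) C D)
    (h : HasCoresolution (R := R) C k M) : HasCoresolution (R := R) C k (M × D) := by
  cases k with
  | zero => trivial
  | succ k =>
    obtain ⟨E, L, f, g, hfg, hL⟩ := h
    refine ⟨ModuleCat.of R (E × D), L, f.prodMap LinearMap.id, g ∘ₗ LinearMap.fst R E D,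
      ⟨hfg.isAddClosure.prod hD, ?_, ?_, ?_, ?_⟩, hL⟩
    · exact hfg.injective.prodMap Function.injective_id
    · rintro ⟨x, d⟩
      refine (hfg.exact x).trans ⟨?_, ?_⟩
      · rintro ⟨y, rfl⟩
        exact ⟨(y, d), rfl⟩
      · rintro ⟨⟨y, d'⟩, h⟩
        exact ⟨y, congrArg Prod.fst h⟩
    · exact hfg.surjective.comp Prod.fst_surjective
    · intro D' _ _ hD' φ
      obtain ⟨ψ, hψ⟩ := hfg.extends_to D' hD' (φ ∘ₗ LinearMap.inl R M D)
      refine ⟨ψ.coprod (φ ∘ₗ LinearMap.inr R M D), ?_⟩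
      rintro ⟨x, d⟩
      simp [hψ, ← map_add]

/-- Cancels D at the cost of enlarging the cosyzygy: the projection M × D → D extends to `ρ` on E,
and the cokernel of M → E becomes L × D. -/
lemma HasCoresolution.of_prod {k : ℕ} (hD : IsAddClosure (R := R) C D)
    (h : HasCoresolution (R := R) C k (M × D)) : HasCoresolution (R := R) C k M := by
  cases k with
  | zero => trivial
  | succ k =>
    obtain ⟨E, L, f, g, hfg, hL⟩ := h
    obtain ⟨ρ, hρ⟩ := hfg.extends_to D hD (LinearMap.snd R M D)
    refine ⟨E, ModuleCat.of R (L × D), f ∘ₗ LinearMap.inl R M D, g.prod ρ,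
      ⟨hfg.isAddClosure, ?_, ?_, ?_, ?_⟩, hL.prod hD⟩
    · exact hfg.injective.comp LinearMap.inl_injective
    · intro x
      constructor
      · intro hx
        have h1 : g x = 0 := congrArg Prod.fst hx
        have h2 : ρ x = 0 := congrArg Prod.snd hx
        obtain ⟨⟨m, d⟩, rfl⟩ := (hfg.exact x).mp h1
        rw [hρ] at h2
        obtain rfl : d = 0 := h2
        exact ⟨m, rfl⟩
      · rintro ⟨m, rfl⟩
        refine Prod.ext ?_ ?_
        · exact hfg.exact.apply_apply_eq_zero _
        · exact hρ _
    · rintro ⟨l, d⟩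
      obtain ⟨x, rfl⟩ := hfg.surjective l
      refine ⟨x + f (0, d - ρ x), Prod.ext ?_ ?_⟩
      · simp [hfg.exact.apply_apply_eq_zero]
      · simp [hρ]
    · intro D' _ _ hD' φ
      obtain ⟨ψ, hψ⟩ := hfg.extends_to D' hD' (φ ∘ₗ LinearMap.fst R M D)
      exact ⟨ψ, fun x => hψ (x, 0)⟩

/-- Dual Schanuel lemma for short exact sequences relative to the additive closure of `C`. -/
lemma IsCostep.nonempty_prod_equiv {D' N' : Type u} [AddCommGroup D'] [Module R D']
    [AddCommGroup N'] [Module R N'] {f : M →ₗ[R] D} {g : D →ₗ[R] N} {f' : M →ₗ[R] D'}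
    {g' : D' →ₗ[R] N'} (h : IsCostep C f g) (h' : IsCostep C f' g') :
    Nonempty ((N × D') ≃ₗ[R] (N' × D)) := by
  obtain ⟨a, ha⟩ := h.extends_to D' h'.isAddClosure f'
  obtain ⟨b, hb⟩ := h'.extends_to D h.isAddClosure f
  -- Both sides are quotients of D × D' by f(M) × 0; `q` kills it because a ∘ f = f' and b ∘ f' = f.
  let p : D × D' →ₗ[R] N × D' := g.prodMap LinearMap.id
  let t : D × D' →ₗ[R] D' := LinearMap.snd R D D' + a ∘ₗ LinearMap.fst R D D'
  let q : D × D' →ₗ[R] N' × D := (g' ∘ₗ t).prod (LinearMap.fst R D D' - b ∘ₗ t)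
  have hp : Function.Surjective p := h.surjective.prodMap Function.surjective_id
  have hq : Function.Surjective q := by
    rintro ⟨n, d⟩
    obtain ⟨x, rfl⟩ := h'.surjective n
    refine ⟨(d + b x, x - a (d + b x)), ?_⟩
    simp [q, t]
  have hker : LinearMap.ker p = LinearMap.ker q := by
    ext ⟨d, d'⟩
    simp only [LinearMap.mem_ker]
    constructor
    · intro hx
      obtain ⟨m, rfl⟩ := (h.exact d).mp (congrArg Prod.fst hx)
      obtain rfl : d' = 0 := congrArg Prod.snd hx
      simp [q, t, ha, hb, h'.exact.apply_apply_eq_zero]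
    · intro hx
      have h1 : g' (d' + a d) = 0 := congrArg Prod.fst hx
      have h2 : d - b (d' + a d) = 0 := congrArg Prod.snd hx
      obtain ⟨m, hm⟩ := (h'.exact _).mp h1
      rw [← hm, hb, sub_eq_zero] at h2
      subst h2
      rw [ha, right_eq_add] at hm
      subst hm
      simp [p, h.exact.apply_apply_eq_zero]
  exact ⟨(p.quotKerEquivOfSurjective hp).symm ≪≫ₗ Submodule.quotEquivOfEq _ _ hker ≪≫ₗ
    q.quotKerEquivOfSurjective hq⟩

/-- A finitely generated module embeds through finitely many copies of `C`. -/
lemma IsCostep.exists_finite [Module.Finite R M] {f : M →ₗ[R] D} {g : D →ₗ[R] N}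
    (h : IsCostep C f g) : ∃ (ι : Type u) (_ : Finite ι) (f' : M →ₗ[R] ι → C),
      IsCostep C f' (LinearMap.range f').mkQ := by
  classical
  obtain ⟨ι, i, s, his⟩ := h.isAddClosure
  obtain ⟨T, hT⟩ := Module.Finite.fg_top (R := R) (M := M)
  -- The finitely many coordinates reached by the generators of M.
  let S : Finset ι := T.biUnion fun m => (i (f m)).support
  let res : (ι →₀ C) →ₗ[R] S → C := LinearMap.pi fun j => Finsupp.lapply j.1
  let inc : (S → C) →ₗ[R] ι →₀ C :=
    Finsupp.lmapDomain C R Subtype.val ∘ₗ (Finsupp.linearEquivFunOnFinite R C S).symm.toLinearMap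
  have hinc : ∀ m : M, inc (res (i (f m))) = i (f m) := by
    have : inc ∘ₗ res ∘ₗ i ∘ₗ f = i ∘ₗ f := by
      refine LinearMap.ext_on hT fun m hm => ?_
      ext j
      by_cases hj : j ∈ S
      · have := Finsupp.mapDomain_apply (f := (Subtype.val : S → ι)) Subtype.val_injective
          ((Finsupp.linearEquivFunOnFinite R C S).symm (res (i (f m)))) ⟨j, hj⟩
        simpa [inc] using this.trans (show res (i (f m)) ⟨j, hj⟩ = i (f m) j from rfl)
      · have h0 : i (f m) j = 0 := by
          by_contra hne
          exact hj (Finset.mem_biUnion.mpr ⟨m, hm, Finsupp.mem_support_iff.mpr hne⟩)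
        have := Finsupp.mapDomain_of_notMem_range (f := (Subtype.val : S → ι))
          ((Finsupp.linearEquivFunOnFinite R C S).symm (res (i (f m)))) j (by simpa using hj)
        simpa [inc, h0] using this
    exact fun m => LinearMap.congr_fun this m
  have hback : ∀ m, s (inc ((res ∘ₗ i ∘ₗ f) m)) = f m := fun m => by
    simp [hinc, his]
  refine ⟨S, inferInstance, res ∘ₗ i ∘ₗ f, isAddClosure_pi S, ?_,
    LinearMap.exact_map_mkQ_range _, Submodule.mkQ_surjective _, ?_⟩
  · intro x y hxy
    exact h.injective (by rw [← hback x, ← hback y, hxy])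
  · intro D' _ _ hD' φ
    obtain ⟨ψ, hψ⟩ := h.extends_to D' hD' φ
    exact ⟨ψ ∘ₗ s ∘ₗ inc, fun x => by simp [hinc, his, hψ]⟩

lemma HasCoresolution.hasFiniteCoresolution [Module.Finite R C] {k : ℕ} [Module.Finite R M]
    (h : HasCoresolution (R := R) C k M) : HasFiniteCoresolution (R := R) C k M := by
  induction k generalizing M with
  | zero => trivial
  | succ k ih =>
    obtain ⟨D, N, f, g, hfg, hN⟩ := h
    obtain ⟨ι, _, f', hf'⟩ := hfg.exists_finite
    refine ⟨ι, inferInstance, ModuleCat.of R ((ι → C) ⧸ LinearMap.range f'), f', _, hf', ?_⟩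
    -- The new cosyzygy agrees with N up to summands from the closure of C, so it inherits the
    -- remaining k steps.
    obtain ⟨e⟩ := hfg.nonempty_prod_equiv hf'
    exact ih (((hN.prod (isAddClosure_pi ι)).of_equiv e).of_prod hfg.isAddClosure)

lemma hasCoresolution_range_dQ (X : CompleteGCResolution R C) (k n : ℕ) :
    HasCoresolution (R := R) C k (LinearMap.range (X.dQ n)) := by
  induction k generalizing n with
  | zero => trivial
  | succ k ih =>
    have := X.projective_Q
    refine ⟨ModuleCat.of R (C ⊗[R] X.Q (n + 1)),
      ModuleCat.of R (LinearMap.range (X.dQ (n + 1))), (LinearMap.range (X.dQ n)).subtype,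
      (X.dQ (n + 1)).rangeRestrict,
      ⟨isAddClosure_tensor _, Subtype.val_injective, ?_, LinearMap.surjective_rangeRestrict _, ?_⟩,
      ih (n + 1)⟩
    · intro x
      rw [← LinearMap.mem_ker, LinearMap.ker_rangeRestrict, LinearMap.mem_ker]
      exact (X.exact_Q n x).trans (by simp)
    · classical
      rintro D' _ _ ⟨ι, i, s, his⟩ φ
      let e := TensorProduct.finsuppScalarRight R R C ι
      -- Hom-exactness is only given for targets C ⊗ W, so D' is viewed as a summand of C ⊗ R^(ι)
      -- and the extension is retracted afterwards.
      obtain ⟨ψ, hψ⟩ : ∃ ψ : C ⊗[R] X.Q (n + 1) →ₗ[R] C ⊗[R] (ι →₀ R),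
          ψ ∘ₗ X.dQ n = e.symm.toLinearMap ∘ₗ i ∘ₗ φ ∘ₗ (X.dQ n).rangeRestrict := by
        cases n with
        | zero =>
          refine (X.hom_exact_δ_Q (ι →₀ R) _).mp (LinearMap.ext fun x => ?_)
          have : (X.dQ 0).rangeRestrict (X.δ x) = 0 :=
            Subtype.ext (X.exact_δ_Q.apply_apply_eq_zero x)
          simp [this]
        | succ n =>
          refine (X.hom_exact_Q (ι →₀ R) n _).mp (LinearMap.ext fun x => ?_)
          have : (X.dQ (n + 1)).rangeRestrict (X.dQ n x) = 0 :=
            Subtype.ext ((X.exact_Q n).apply_apply_eq_zero x)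
          simp [this]
      refine ⟨s ∘ₗ e.toLinearMap ∘ₗ ψ, ?_⟩
      rintro ⟨_, x, rfl⟩
      have := LinearMap.congr_fun hψ x
      simp only [LinearMap.comp_apply] at this
      simp only [LinearMap.comp_apply, Submodule.subtype_apply, this]
      simpa using! his _

lemma hasCoresolution_of_isGCProjective (h : IsGCProjective R C M) (k : ℕ) :
    HasCoresolution (R := R) C k M := by
  obtain ⟨X, ⟨e⟩⟩ := h
  refine HasCoresolution.of_equiv e.symm ?_
  cases k with
  | zero => trivial
  | succ k =>
    have := X.projective_Q
    refine ⟨ModuleCat.of R (C ⊗[R] X.Q 0),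
      ModuleCat.of R (LinearMap.range (X.dQ 0)), (LinearMap.range X.δ).subtype,
      (X.dQ 0).rangeRestrict,
      ⟨isAddClosure_tensor _, Subtype.val_injective, ?_, LinearMap.surjective_rangeRestrict _, ?_⟩,
      hasCoresolution_range_dQ X k 0⟩
    · intro x
      rw [← LinearMap.mem_ker, LinearMap.ker_rangeRestrict, LinearMap.mem_ker]
      exact (X.exact_δ_Q x).trans (by simp)
    · classical
      rintro D' _ _ ⟨ι, i, s, his⟩ φ
      let e := TensorProduct.finsuppScalarRight R R C ι
      obtain ⟨ψ, hψ⟩ : ∃ ψ : C ⊗[R] X.Q 0 →ₗ[R] C ⊗[R] (ι →₀ R),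
          ψ ∘ₗ X.δ = e.symm.toLinearMap ∘ₗ i ∘ₗ φ ∘ₗ X.δ.rangeRestrict := by
        refine (X.hom_exact_P_δ (ι →₀ R) _).mp (LinearMap.ext fun x => ?_)
        have : X.δ.rangeRestrict (X.dP 0 x) = 0 :=
          Subtype.ext (X.exact_P_δ.apply_apply_eq_zero x)
        simp [this]
      refine ⟨s ∘ₗ e.toLinearMap ∘ₗ ψ, ?_⟩
      rintro ⟨_, x, rfl⟩
      have := LinearMap.congr_fun hψ x
      simp only [LinearMap.comp_apply] at this
      simp only [LinearMap.comp_apply, Submodule.subtype_apply, this]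
      simpa using! his _

end RelativeCoresolutions

/-! ### Duality with respect to C and finite presentation -/

section Duality

variable {R : Type u} [CommRing R] {C : Type u} [AddCommGroup C] [Module R C]
variable {M N D : Type u} [AddCommGroup M] [Module R M] [AddCommGroup N] [Module R N]
  [AddCommGroup D] [Module R D]

/-- If the homothety map of `C` is bijective, then `Hom_R(C^n, C)` is free of rank `n`. -/
lemma nonempty_equiv_hom_pi (hC : Function.Bijective (LinearMap.lsmul R C : R →ₗ[R] C →ₗ[R] C))
    (ι : Type u) [Finite ι] : Nonempty ((ι → R) ≃ₗ[R] ((ι → C) →ₗ[R] C)) := by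
  classical
  have := Fintype.ofFinite ι
  exact ⟨(LinearEquiv.piCongrRight fun _ => LinearEquiv.ofBijective _ hC) ≪≫ₗ
    LinearMap.lsum R (fun _ : ι => C) R⟩

lemma applyₗ_pi_surjective
    (hC : Function.Bijective (LinearMap.lsmul R C : R →ₗ[R] C →ₗ[R] C)) (ι : Type u) [Finite ι] :
    Function.Surjective
      (LinearMap.applyₗ : (ι → C) →ₗ[R] ((ι → C) →ₗ[R] C) →ₗ[R] C) := by
  classical
  have := Fintype.ofFinite ι
  intro φ
  refine ⟨fun i => φ (LinearMap.proj i), LinearMap.ext fun e => ?_⟩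
  choose r hr using fun i => hC.surjective (e ∘ₗ LinearMap.single R (fun _ : ι => C) i)
  have he : e = ∑ i, r i • (LinearMap.proj i : (ι → C) →ₗ[R] C) := by
    refine LinearMap.pi_ext' fun i => LinearMap.ext fun c => ?_
    rw [← hr i]
    simp [Pi.single_apply]
  simp [he]

lemma IsCostep.lcomp_surjective {f : M →ₗ[R] D} {g : D →ₗ[R] N} (h : IsCostep C f g) :
    Function.Surjective (LinearMap.lcomp R C f) := fun φ => by
  obtain ⟨ψ, hψ⟩ := h.extends_to C isAddClosure_self φ
  exact ⟨ψ, LinearMap.ext hψ⟩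

lemma IsCostep.nonempty_hom_equiv_ker {f : M →ₗ[R] D} {g : D →ₗ[R] N} (h : IsCostep C f g) :
    Nonempty ((N →ₗ[R] C) ≃ₗ[R] LinearMap.ker (LinearMap.lcomp R C f)) := by
  have hex := LinearMap.exact_lcomp_of_exact_of_surjective C h.exact h.surjective
  rw [LinearMap.exact_iff] at hex
  exact ⟨LinearEquiv.ofInjective _ (LinearMap.lcomp_injective_of_surjective g h.surjective) ≪≫ₗ
    LinearEquiv.ofEq _ _ hex.symm⟩

/-- The dual of a module with one coresolution step is finitely generated. -/
lemma finite_hom (hC : Function.Bijective (LinearMap.lsmul R C : R →ₗ[R] C →ₗ[R] C))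
    (h : HasFiniteCoresolution (R := R) C 1 M) : Module.Finite R (M →ₗ[R] C) := by
  obtain ⟨ι, _, N, f, g, hfg, -⟩ := h
  obtain ⟨e⟩ := nonempty_equiv_hom_pi hC ι
  exact Module.Finite.of_surjective (LinearMap.lcomp R C f ∘ₗ e.toLinearMap)
    (hfg.lcomp_surjective.comp e.surjective)

/-- M* is the quotient of Hom(C^ι, C) ≅ R^ι by N*, and the second step makes N* finitely generated.
-/
lemma finitePresentation_hom
    (hC : Function.Bijective (LinearMap.lsmul R C : R →ₗ[R] C →ₗ[R] C))
    (h : HasFiniteCoresolution (R := R) C 2 M) :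
    Module.FinitePresentation R (M →ₗ[R] C) := by
  obtain ⟨ι, _, N, f, g, hfg, hN⟩ := h
  obtain ⟨e⟩ := nonempty_equiv_hom_pi hC ι
  have := Module.FinitePresentation.of_equiv e
  have := finite_hom hC hN
  obtain ⟨e'⟩ := hfg.nonempty_hom_equiv_ker
  refine Module.finitePresentation_of_surjective _ hfg.lcomp_surjective ?_
  exact Module.Finite.iff_fg.mp (Module.Finite.equiv e')

/-- Biduality with respect to `C`. -/
lemma applyₗ_bijective (hC : Function.Bijective (LinearMap.lsmul R C : R →ₗ[R] C →ₗ[R] C))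
    (h : HasFiniteCoresolution (R := R) C 2 M) :
    Function.Bijective (LinearMap.applyₗ : M →ₗ[R] (M →ₗ[R] C) →ₗ[R] C) := by
  obtain ⟨ι, _, N, f, g, hfg, κ, _, _, f', _, hfg', -⟩ := h
  constructor
  · rw [injective_iff_map_eq_zero]
    intro m hm
    refine (injective_iff_map_eq_zero f).mp hfg.injective m (funext fun i => ?_)
    exact LinearMap.congr_fun hm (LinearMap.proj i ∘ₗ f)
  · intro φ
    -- Biduality for C^ι turns φ into evaluation at some d. Since N embeds in a power of C and maps
    -- factoring through g vanish on M, d lies in the image of M.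
    obtain ⟨d, hd⟩ := applyₗ_pi_surjective hC ι (φ ∘ₗ LinearMap.lcomp R C f)
    replace hd : ∀ ψ : (ι → C) →ₗ[R] C, ψ d = φ (ψ ∘ₗ f) := fun ψ => LinearMap.congr_fun hd ψ
    have hgd : g d = 0 := by
      refine (injective_iff_map_eq_zero f').mp hfg'.injective _ (funext fun i => ?_)
      refine (hd (LinearMap.proj i ∘ₗ f' ∘ₗ g)).trans ?_
      rw [LinearMap.comp_assoc, LinearMap.comp_assoc, hfg.exact.linearMap_comp_eq_zero]
      simp
    obtain ⟨m, rfl⟩ := (hfg.exact d).mp hgd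
    refine ⟨m, LinearMap.ext fun ψ => ?_⟩
    obtain ⟨ψ', rfl⟩ := hfg.lcomp_surjective ψ
    exact hd ψ'

/-- If `0 → M → D → N → 0` is exact, `D` is finitely presented and `N` is a quotient of a
projective module by a finitely presented submodule, then `M` is finitely presented. -/
lemma finitePresentation_of_exact {F : Type u} [AddCommGroup F] [Module R F]
    [Module.Projective R F] [Module.FinitePresentation R D]
    {f : M →ₗ[R] D} {g : D →ₗ[R] N} (hf : Function.Injective f) (hfg : Function.Exact f g)
    (hg : Function.Surjective g) (π : F →ₗ[R] N) (hπ : Function.Surjective π)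
    [Module.FinitePresentation R (LinearMap.ker π)] : Module.FinitePresentation R M := by
  let δ : D × F →ₗ[R] N := g ∘ₗ LinearMap.fst R D F - π ∘ₗ LinearMap.snd R D F
  -- The pullback of D and F over N: an extension of D by ker π, hence finitely presented, and also
  -- an extension of F by M, which splits.
  let Y := LinearMap.ker δ
  have hY : ∀ y : Y, g y.1.1 = π y.1.2 := fun y => sub_eq_zero.mp y.2
  let p : Y →ₗ[R] D := LinearMap.fst R D F ∘ₗ Y.subtype
  let q : Y →ₗ[R] F := LinearMap.snd R D F ∘ₗ Y.subtype
  have hp : Function.Surjective p := fun d => by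
    obtain ⟨x, hx⟩ := hπ (g d)
    exact ⟨⟨(d, x), sub_eq_zero.mpr hx.symm⟩, rfl⟩
  have hq : Function.Surjective q := fun x => by
    obtain ⟨d, hd⟩ := hg (π x)
    exact ⟨⟨(d, x), sub_eq_zero.mpr hd⟩, rfl⟩
  let j : LinearMap.ker π →ₗ[R] LinearMap.ker p :=
    LinearMap.codRestrict _ (LinearMap.codRestrict Y
      (LinearMap.inr R D F ∘ₗ (LinearMap.ker π).subtype) fun x => by simp [Y, δ])
      fun x => rfl
  have hj : Function.Bijective j := by
    constructor
    · intro x y hxy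
      exact Subtype.ext (congrArg (fun z : LinearMap.ker p => z.1.1.2) hxy)
    · rintro ⟨⟨⟨d, x⟩, hx⟩, hd⟩
      obtain rfl : d = 0 := hd
      have hx' : g 0 = π x := hY ⟨(0, x), hx⟩
      rw [map_zero] at hx'
      exact ⟨⟨x, hx'.symm⟩, rfl⟩
  have : Module.FinitePresentation R (LinearMap.ker p) :=
    Module.FinitePresentation.of_equiv (R := R) (M := LinearMap.ker π) (N := LinearMap.ker p)
      (LinearEquiv.ofBijective j hj)
  have := Module.finitePresentation_of_ker p hp
  let i : M →ₗ[R] Y := LinearMap.codRestrict Y (LinearMap.inl R D F ∘ₗ f) fun x => by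
    simp [Y, δ, hfg.apply_apply_eq_zero]
  refine Module.finitePresentation_of_projective_of_exact i q ?_ hq ?_
  · intro x y hxy
    exact hf (congrArg (fun z : Y => z.1.1) hxy)
  · rintro ⟨⟨d, x⟩, hx⟩
    constructor
    · intro h
      obtain rfl : x = 0 := h
      have hd : g d = π 0 := hY ⟨(d, 0), hx⟩
      rw [map_zero] at hd
      obtain ⟨m, rfl⟩ := (hfg d).mp hd
      exact ⟨m, rfl⟩
    · rintro ⟨m, hm⟩
      exact (congrArg (fun z : Y => z.1.2) hm).symm

lemma finitePresentation_of_hasDegreewiseFiniteProjectiveResolution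
    (h : HasDegreewiseFiniteProjectiveResolution R C) : Module.FinitePresentation R C := by
  obtain ⟨P, d, ε, hfin, hproj, hε, hexact, -⟩ := h
  have := Module.finitePresentation_of_projective R (P 0)
  refine Module.finitePresentation_of_surjective ε hε ?_
  rw [LinearMap.exact_iff.mp hexact]
  exact Module.Finite.iff_fg.mp inferInstance

end Duality

/-! ### Finitely generated submodules of projectives -/

/-- Over a `G_C`-hereditary ring, finitely generated modules embedding in a projective module
have finite coresolutions of any length. -/
lemma hasFiniteCoresolution_of_injective {R : Type u} [CommRing R] {C : Type u} [AddCommGroup C]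
    [Module R C] [Module.Finite R C] (hR : IsGCHereditary R C) {M P : Type u} [AddCommGroup M]
    [Module R M] [AddCommGroup P] [Module R P] [Module.Finite R M] [Module.Projective R P]
    (f : M →ₗ[R] P) (hf : Function.Injective f) (k : ℕ) :
    HasFiniteCoresolution (R := R) C k M :=
  ((hasCoresolution_of_isGCProjective (hR P (LinearMap.range f)) k).of_equiv
    (LinearEquiv.ofInjective f hf).symm).hasFiniteCoresolution

/-- Over a `G_C`-hereditary ring, finitely generated submodules of projective modules are finitely
presented. -/
lemma finitePresentation_of_injective {R : Type u} [CommRing R] {C : Type u} [AddCommGroup C]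
    [Module R C] (hC : IsSemidualizing R C) (hR : IsGCHereditary R C) {M P : Type u}
    [AddCommGroup M] [Module R M] [AddCommGroup P] [Module R P] [Module.Finite R M]
    [Module.Projective R P] (i : M →ₗ[R] P) (hi : Function.Injective i) :
    Module.FinitePresentation R M := by
  have := finitePresentation_of_hasDegreewiseFiniteProjectiveResolution hC.resolution
  -- Three steps leave two for N, as biduality requires.
  obtain ⟨ι, _, N, f, g, hfg, hN⟩ := hasFiniteCoresolution_of_injective hR i hi 3
  -- The dual of `N` is again a finitely generated submodule of a free module.
  have : Module.Finite R (N →ₗ[R] C) := by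
    obtain ⟨κ, h, L, a, b, hab, -⟩ := hN
    exact finite_hom hC.homothety ⟨κ, h, L, a, b, hab, trivial⟩
  obtain ⟨e⟩ := nonempty_equiv_hom_pi hC.homothety ι
  obtain ⟨κ, _, L, a, b, hab, hL⟩ := hasFiniteCoresolution_of_injective hR
    (e.symm.toLinearMap ∘ₗ LinearMap.lcomp R C g)
    (e.symm.injective.comp (LinearMap.lcomp_injective_of_surjective g hfg.surjective)) 3
  -- L* is the kernel of the surjection Hom(C^κ, C) → N** ≅ N from a free module.
  have := finitePresentation_hom hC.homothety hL
  obtain ⟨eL⟩ := hab.nonempty_hom_equiv_ker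
  have := Module.FinitePresentation.of_equiv eL
  obtain ⟨e'⟩ := nonempty_equiv_hom_pi hC.homothety κ
  have := Module.Projective.of_equiv e'
  let ev := LinearEquiv.ofBijective _ (applyₗ_bijective hC.homothety hN)
  have hker : LinearMap.ker (ev.symm.toLinearMap ∘ₗ LinearMap.lcomp R C a) =
      LinearMap.ker (LinearMap.lcomp R C a) := LinearEquiv.ker_comp _ _
  have : Module.FinitePresentation R
      (LinearMap.ker (ev.symm.toLinearMap ∘ₗ LinearMap.lcomp R C a)) := by
    rwa [hker]
  exact finitePresentation_of_exact hfg.injective hfg.exact hfg.surjective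
    (ev.symm.toLinearMap ∘ₗ LinearMap.lcomp R C a)
    (ev.symm.surjective.comp hab.lcomp_surjective)

end GCHereditary

theorem corollary3p4 {R : Type u} [CommRing R] (C : Type u) [AddCommGroup C] [Module R C]
    (hC : IsSemidualizing R C) (hR : IsGCHereditary R C) : IsCoherentCommRing R := by
  intro I hI
  have : Module.Finite R I := Module.Finite.iff_fg.mpr hI
  exact GCHereditary.finitePresentation_of_injective hC hR I.subtype Subtype.val_injective
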